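/- Let $k$ be an infinite field, let $R=k[x_1,\dots,x_m]$ be the standard graded polynomial ring, and let $I\subseteq R$ be a homogeneous ideal. For a linear map $\lambda:\mathbb Z^m\to\mathbb Z$, the weight of a monomial $x_1^{s_1}\cdots x_m^{s_m}$ is $\lambda(s_1,\dots,s_m)$; for $f\in R$ let $\operatorname{in}_\lambda(f)$ be the sum of the terms of $f$ of maximal weight (with $\operatorname{in}_\lambda(0)=0$), and let $\operatorname{in}_\lambda(I)$ be the ideal generated by $\{\operatorname{in}_\lambda(f) : f\in I\}$. For a homogeneous ideal $J\subseteq R$ put $A=R/J=\bigoplus_{n\ge 0}A_n$. A reduction of $A$ is an ideal $Q$ of $A$ generated by linear forms (elements of $A_1$) such that $Q\cap A_n=A_n$ for all large $n$; it is minimal if it contains no other reduction of $A$. For a reduction $Q$, let $r_Q(A)$ be the least integer $n\ge 0$ with $Q\cap A_{n+1}=A_{n+1}$, and let $r(A)=\min\{r_Q(A) : Q \text{ a minimal reduction of } A\}$. Then for every linear map $\lambda:\mathbb Z^m\to\mathbb Z$, $$r(R/I)\le r(R/\operatorname{in}_\lambda(I)).$$ -/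

import Mathlib

attribute [local instance] MvPolynomial.gradedAlgebra

section GradedReductions

variable {k A : Type*} [Field k] [CommRing A] [Algebra k A]

/-- Let `A` be a `k`-algebra with graded pieces `𝒜 n`. A reduction of `A` is an ideal `Q` generated
by linear forms (elements of `𝒜 1`) with `Q ∩ 𝒜 n = 𝒜 n` for all large `n`. -/
def IsReduction (𝒜 : ℕ → Submodule k A) (Q : Ideal A) : Prop :=
  (∃ s : Set A, s ⊆ (𝒜 1 : Set A) ∧ Q = Ideal.span s) ∧
    ∃ N : ℕ, ∀ n, N ≤ n → 𝒜 n ≤ Q.restrictScalars k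

/-- A reduction is minimal if it contains no other reduction. -/
def IsMinimalReduction (𝒜 : ℕ → Submodule k A) (Q : Ideal A) : Prop :=
  IsReduction 𝒜 Q ∧ ∀ Q' : Ideal A, IsReduction 𝒜 Q' → Q' ≤ Q → Q' = Q

/-- The reduction number of `A` with respect to a reduction `Q`: the least `n ≥ 0` such that
`Q ∩ 𝒜 (n + 1) = 𝒜 (n + 1)`. -/
noncomputable def reductionNumberWrt (𝒜 : ℕ → Submodule k A) (Q : Ideal A) : ℕ :=
  sInf {n : ℕ | 𝒜 (n + 1) ≤ Q.restrictScalars k}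

/-- The reduction number of `A`: the minimum of the reduction numbers with respect to the minimal
reductions of `A`. -/
noncomputable def reductionNumber (𝒜 : ℕ → Submodule k A) : ℕ :=
  sInf {r : ℕ | ∃ Q : Ideal A, IsMinimalReduction 𝒜 Q ∧ reductionNumberWrt 𝒜 Q = r}

end GradedReductions

section InitialIdeals

variable {k : Type*} [Field k] {m : ℕ}

/-- The degree `n` piece of `k[x₁, …, xₘ] / I`: the image of the forms of degree `n`. -/
noncomputable def quotientPiece (I : Ideal (MvPolynomial (Fin m) k)) (n : ℕ) :
    Submodule k (MvPolynomial (Fin m) k ⧸ I) :=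
  (MvPolynomial.homogeneousSubmodule (Fin m) k n).map (Ideal.Quotient.mkₐ k I).toLinearMap

/-- The weight `w(s₁, …, sₘ)` of the monomial `x₁ ^ s₁ ⋯ xₘ ^ sₘ`. -/
def monomialWeight (w : (Fin m → ℤ) →ₗ[ℤ] ℤ) (s : Fin m →₀ ℕ) : ℤ :=
  w fun i => (s i : ℤ)

open Classical in
/-- The initial form of `f` for the weight `w`: the sum of the terms of `f` of maximal weight. -/
noncomputable def initialForm (w : (Fin m → ℤ) →ₗ[ℤ] ℤ) (f : MvPolynomial (Fin m) k) :
    MvPolynomial (Fin m) k :=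
  ∑ s ∈ f.support with ∀ s' ∈ f.support, monomialWeight w s' ≤ monomialWeight w s,
    MvPolynomial.monomial s (f.coeff s)

/-- The initial ideal of `I` for the weight `w`, generated by the initial forms of the elements
of `I`. -/
noncomputable def initialIdeal (w : (Fin m → ℤ) →ₗ[ℤ] ℤ) (I : Ideal (MvPolynomial (Fin m) k)) :
    Ideal (MvPolynomial (Fin m) k) :=
  Ideal.span {g | ∃ f ∈ I, g = initialForm w f}

end InitialIdeals

/-! ### Reductions and the linear forms they contain -/

section LinearForms

open MvPolynomial

variable {k : Type*} [Field k] {m : ℕ}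

/-! Write `J` for the initial ideal. Take a minimal reduction of `R / J` with the smallest reduction
number `r`, generated by as few linear forms `y₁, …, y_d` as possible, so that `J + (y)` contains
all forms of degree `r + 1`. The torus action degenerates `I` to `J` as `u → 0`, and containing all
forms of a given degree is an open condition (a determinant does not vanish). Hence for some `u ≠ 0`
the translated forms `z` satisfy the same condition with `I`
(`exists_forms_mem_sup_span_of_initialIdeal`), and `(z)` is a reduction of `R / I` with reduction
number at most `r`.

It remains to see that `(z)` is minimal. By the choice of `d`, the `y` are algebraically independent
modulo `J` if `d > 0` (`algebraicIndependent_of_minimal`), so the Hilbert function of `R / J` grows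
at least like `n ^ d`. It is bounded by that of `R / I` (`finrank_filteredPiece_initialIdeal_le`),
which grows at most like `n ^ e` if `e` linear forms generate a reduction. So every reduction of `R
/ I` contains at least `d` independent linear forms, while `(z)` contains at most `d`. -/

theorem quotientPiece_le_map_iff (I K : Ideal (MvPolynomial (Fin m) k)) (n : ℕ) :
    quotientPiece I n ≤ (K.map (Ideal.Quotient.mk I)).restrictScalars k ↔
      ∀ p : MvPolynomial (Fin m) k, p.IsHomogeneous n → p ∈ I ⊔ K := by
  rw [quotientPiece, Submodule.map_le_iff_le_comap]
  refine forall_congr' fun p => ?_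
  rw [mem_homogeneousSubmodule, sup_comm, ← Ideal.mem_quotient_iff_mem_sup]
  rfl

theorem exists_forms_mem_of_idealOfVars_le_radical {K : Ideal (MvPolynomial (Fin m) k)}
    (hle : idealOfVars (Fin m) k ≤ K.radical) :
    ∃ M, ∀ n, M ≤ n → ∀ p : MvPolynomial (Fin m) k, p.IsHomogeneous n → p ∈ K := by
  obtain ⟨M, hM⟩ := Ideal.exists_pow_le_of_le_radical_of_fg hle (IsNoetherian.noetherian _)
  refine ⟨M, fun n hn p hp => hM ?_⟩
  rw [mem_pow_idealOfVars_iff']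
  exact fun s hs => hp.coeff_eq_zero (hs.trans_le hn).ne

theorem exists_forms_mem_of_X_pow_mem {K : Ideal (MvPolynomial (Fin m) k)} {N : ℕ}
    (h : ∀ i, X i ^ N ∈ K) :
    ∃ M, ∀ n, M ≤ n → ∀ p : MvPolynomial (Fin m) k, p.IsHomogeneous n → p ∈ K := by
  refine exists_forms_mem_of_idealOfVars_le_radical ?_
  rw [idealOfVars, Ideal.span_le]
  rintro _ ⟨i, rfl⟩
  exact ⟨N, h i⟩

theorem exists_forms_mem_of_forms_mem {K : Ideal (MvPolynomial (Fin m) k)} {N : ℕ}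
    (h : ∀ p : MvPolynomial (Fin m) k, p.IsHomogeneous N → p ∈ K) :
    ∃ M, ∀ n, M ≤ n → ∀ p : MvPolynomial (Fin m) k, p.IsHomogeneous n → p ∈ K :=
  exists_forms_mem_of_X_pow_mem fun i => h _ (isHomogeneous_X_pow i N)

instance quotientPiece_finite (I : Ideal (MvPolynomial (Fin m) k)) (n : ℕ) :
    Module.Finite k (quotientPiece I n) :=
  Module.Finite.iff_fg.2 ((homogeneousSubmodule_fg (Fin m) k n).map _)

/-- The dimension of the space of linear forms of `k[x₁, …, xₘ] / I` lying in `Q`. -/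
noncomputable def linearRank (I : Ideal (MvPolynomial (Fin m) k))
    (Q : Ideal (MvPolynomial (Fin m) k ⧸ I)) : ℕ :=
  Module.finrank k ↥(Q.restrictScalars k ⊓ quotientPiece I 1)

theorem span_inf_quotientPiece {I : Ideal (MvPolynomial (Fin m) k)}
    {Q : Ideal (MvPolynomial (Fin m) k ⧸ I)} (hQ : IsReduction (quotientPiece I) Q) :
    Ideal.span (↑(Q.restrictScalars k ⊓ quotientPiece I 1) : Set (MvPolynomial (Fin m) k ⧸ I)) =
      Q := by
  obtain ⟨⟨s, hs, rfl⟩, -⟩ := hQ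
  refine le_antisymm (Ideal.span_le.2 fun x hx => hx.1) (Ideal.span_mono fun x hx => ?_)
  exact ⟨Ideal.subset_span hx, hs hx⟩

/-- A reduction is generated by its degree-one part, so minimality can be certified by counting
dimensions. -/
theorem eq_of_le_of_linearRank_le {I : Ideal (MvPolynomial (Fin m) k)}
    {Q Q' : Ideal (MvPolynomial (Fin m) k ⧸ I)} (hQ : IsReduction (quotientPiece I) Q)
    (hQ' : IsReduction (quotientPiece I) Q') (hle : Q' ≤ Q)
    (hr : linearRank I Q ≤ linearRank I Q') : Q' = Q := by
  have : Q'.restrictScalars k ⊓ quotientPiece I 1 = Q.restrictScalars k ⊓ quotientPiece I 1 :=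
    Submodule.eq_of_le_of_finrank_le (inf_le_inf_right _ hle) hr
  rw [← span_inf_quotientPiece hQ, ← span_inf_quotientPiece hQ', this]

theorem exists_generators {I : Ideal (MvPolynomial (Fin m) k)}
    {Q : Ideal (MvPolynomial (Fin m) k ⧸ I)} (hQ : IsReduction (quotientPiece I) Q) :
    ∃ y : Fin (linearRank I Q) → MvPolynomial (Fin m) k, (∀ i, (y i).IsHomogeneous 1) ∧
      Q = (Ideal.span (Set.range y)).map (Ideal.Quotient.mk I) := by
  let V := Q.restrictScalars k ⊓ quotientPiece I 1
  let b := Module.finBasis k V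
  have hb : ∀ i, ∃ p : MvPolynomial (Fin m) k, p.IsHomogeneous 1 ∧
      Ideal.Quotient.mk I p = (b i : MvPolynomial (Fin m) k ⧸ I) := fun i => (b i).2.2
  choose y hy hyb using hb
  refine ⟨y, hy, ?_⟩
  have hmap : (Ideal.span (Set.range y)).map (Ideal.Quotient.mk I) =
      Ideal.span (Set.range (Ideal.Quotient.mk I ∘ y)) := by
    rw [Ideal.map_span, ← Set.range_comp]
  refine Eq.trans ?_ hmap.symm
  refine le_antisymm ?_ (Ideal.span_le.2 ?_)
  · rw [← span_inf_quotientPiece hQ, Ideal.span_le]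
    intro x hx
    have h1 := b.sum_repr ⟨x, hx⟩
    have h2 := congrArg (Subtype.val) h1
    rw [AddSubmonoidClass.coe_finsetSum] at h2
    change _ = x at h2
    rw [← h2]
    refine Submodule.sum_mem _ fun i _ => ?_
    rw [Submodule.coe_smul, ← hyb]
    exact Submodule.smul_of_tower_mem _ _ (Ideal.subset_span ⟨i, rfl⟩)
  · rintro _ ⟨i, rfl⟩
    change Ideal.Quotient.mk I (y i) ∈ Q
    rw [hyb]
    exact (b i).2.1

theorem isReduction_map_span {I : Ideal (MvPolynomial (Fin m) k)} {ι : Type*}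
    {y : ι → MvPolynomial (Fin m) k} (hy : ∀ i, (y i).IsHomogeneous 1)
    (h : ∃ N, ∀ n, N ≤ n → ∀ p : MvPolynomial (Fin m) k, p.IsHomogeneous n →
      p ∈ I ⊔ Ideal.span (Set.range y)) :
    IsReduction (quotientPiece I)
      ((Ideal.span (Set.range y)).map (Ideal.Quotient.mk I)) := by
  refine ⟨⟨Ideal.Quotient.mk I '' Set.range y, ?_, Ideal.map_span _ _⟩, ?_⟩
  · rintro _ ⟨_, ⟨i, rfl⟩, rfl⟩
    exact ⟨y i, hy i, rfl⟩
  · simpa only [quotientPiece_le_map_iff] using h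

/-- The irrelevant ideal is a reduction; one of least `linearRank` is minimal. -/
theorem exists_isMinimalReduction (I : Ideal (MvPolynomial (Fin m) k)) :
    ∃ Q, IsMinimalReduction (quotientPiece I) Q := by
  have hne : {Q | IsReduction (quotientPiece I) Q}.Nonempty := by
    refine ⟨_, isReduction_map_span (y := fun i : Fin m => X i)
      (fun i => isHomogeneous_X k i) (exists_forms_mem_of_X_pow_mem (N := 1) fun i => ?_)⟩
    rw [pow_one]
    exact Ideal.mem_sup_right (Ideal.subset_span ⟨i, rfl⟩)
  let Q := Function.argminOn (linearRank I) _ hne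
  have hQ : IsReduction (quotientPiece I) Q := Function.argminOn_mem (linearRank I) _ hne
  exact ⟨Q, hQ, fun Q' hQ' hle => eq_of_le_of_linearRank_le hQ hQ' hle
    (Function.argminOn_le (linearRank I) _ hQ')⟩

/-- A form of degree `n + 1` in `I + (y)` is a combination of the `y i` with coefficients
forms of degree `n`, modulo `I`. -/
theorem exists_forms_coeff_of_mem_sup_span {I : Ideal (MvPolynomial (Fin m) k)}
    (hI : I.IsHomogeneous (homogeneousSubmodule (Fin m) k)) {ι : Type*} [Fintype ι]
    {y : ι → MvPolynomial (Fin m) k} (hy : ∀ i, (y i).IsHomogeneous 1) {n : ℕ}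
    {p : MvPolynomial (Fin m) k} (hp : p.IsHomogeneous (n + 1))
    (hmem : p ∈ I ⊔ Ideal.span (Set.range y)) :
    ∃ q : ι → MvPolynomial (Fin m) k, (∀ i, (q i).IsHomogeneous n) ∧
      p - ∑ i, q i * y i ∈ I := by
  obtain ⟨a, ha, b, hb, rfl⟩ := Submodule.mem_sup.1 hmem
  obtain ⟨c, rfl⟩ := (Ideal.mem_span_range_iff_exists_fun).1 hb
  refine ⟨fun i => homogeneousComponent n (c i), fun i => homogeneousComponent_isHomogeneous _ _, ?_⟩
  have h1 : ∀ i, homogeneousComponent (n + 1) (c i * y i) = homogeneousComponent n (c i) * y i := by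
    intro i
    have := DirectSum.coe_decompose_mul_add_of_right_mem
      (homogeneousSubmodule (Fin m) k) (i := n) (a := c i) (hy i)
    exact ((decomposition.decompose'_apply _ _).symm.trans this).trans
      (congrArg (· * y i) (decomposition.decompose'_apply _ _))
  have h2 := homogeneousComponent_eq_self hp
  rw [← h2, map_add, map_sum]
  simp only [h1, add_sub_cancel_right]
  exact homogeneousComponent_mem_of_mem hI ha _

/-- In degree one the coefficients of the `y i` can be taken of degree zero, that is, scalars. -/
theorem linearRank_map_span_le {I : Ideal (MvPolynomial (Fin m) k)}
    (hI : I.IsHomogeneous (homogeneousSubmodule (Fin m) k)) {d : ℕ}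
    {y : Fin d → MvPolynomial (Fin m) k} (hy : ∀ i, (y i).IsHomogeneous 1) :
    linearRank I ((Ideal.span (Set.range y)).map (Ideal.Quotient.mk I)) ≤ d := by
  have hle : ((Ideal.span (Set.range y)).map (Ideal.Quotient.mk I)).restrictScalars k ⊓
      quotientPiece I 1 ≤ Submodule.span k (Set.range (Ideal.Quotient.mk I ∘ y)) := by
    rintro _ ⟨hQ, p, hp, rfl⟩
    have hmem : p ∈ I ⊔ Ideal.span (Set.range y) := by
      rw [sup_comm, ← Ideal.mem_quotient_iff_mem_sup]
      exact hQ
    obtain ⟨q, hq, h⟩ := exists_forms_coeff_of_mem_sup_span hI hy (n := 0) hp hmem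
    have h3 := (Ideal.Quotient.mk_eq_mk_iff_sub_mem p _).2 h
    change Ideal.Quotient.mk I p ∈ _
    rw [h3, map_sum]
    refine Submodule.sum_mem _ fun i _ => ?_
    obtain ⟨c, hc⟩ : ∃ c, q i = C c :=
      ⟨_, totalDegree_eq_zero_iff_eq_C.1
        ((totalDegree_zero_iff_isHomogeneous _).2 (hq i))⟩
    rw [hc, ← smul_eq_C_mul]
    exact Submodule.smul_mem _ c (Submodule.subset_span (Set.mem_range_self i))
  have : Module.Finite k (Submodule.span k (Set.range (Ideal.Quotient.mk I ∘ y))) :=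
    Module.Finite.span_of_finite k (Set.finite_range _)
  calc _ ≤ _ := Submodule.finrank_mono hle
    _ ≤ Fintype.card (Fin d) := finrank_range_le_card _
    _ = d := Fintype.card_fin d

end LinearForms

/-! ### Algebraic independence of a shortest system of generators -/

section AlgebraicIndependence

open MvPolynomial

variable {k : Type*} [Field k] {m : ℕ}

theorem aeval_smul_of_isHomogeneous {σ B : Type*} [CommRing B] [Algebra k B]
    {F : MvPolynomial σ k} {n : ℕ} (hF : F.IsHomogeneous n) (c : σ → k) (v : B) :
    aeval (fun j => c j • v) F = eval c F • v ^ n := by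
  rw [aeval_def, eval₂_eq, eval_eq, Finset.sum_smul]
  refine Finset.sum_congr rfl fun s hs => ?_
  rw [hF.degree_eq_sum_deg_support hs, ← Algebra.smul_def, mul_smul]
  simp only [Algebra.smul_def, mul_pow, Finset.prod_mul_distrib, map_prod, map_pow,
    Finset.prod_pow_eq_pow_sum]

theorem aeval_homogeneousComponent {ι : Type*} {y : ι → MvPolynomial (Fin m) k}
    (hy : ∀ i, (y i).IsHomogeneous 1) (F : MvPolynomial ι k) (n : ℕ) :
    aeval y (homogeneousComponent n F) = homogeneousComponent n (aeval y F) := by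
  have h : ∀ i, (aeval y (homogeneousComponent i F)).IsHomogeneous i := fun i => by
    simpa using (homogeneousComponent_isHomogeneous i F).aeval y hy
  conv_rhs => rw [← sum_homogeneousComponent F, map_sum, map_sum]
  simp only [homogeneousComponent_of_mem (h _)]
  rw [Finset.sum_ite_eq]
  split_ifs with hn
  · rfl
  · rw [homogeneousComponent_eq_zero _ _ (by simpa using hn), map_zero]

/-- Noether normalization: choose a point `c` with `c 0 = 1` and `F(c) ≠ 0`, and let `z` consist of
the `y j - c j * y 0` for `j ≠ 0`. Modulo `J + (z)` the relation becomes `F(c) * y 0 ^ n = 0`, so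
every `y j` is nilpotent there. -/
theorem exists_fewer_generators [Infinite k] {J : Ideal (MvPolynomial (Fin m) k)} {d : ℕ}
    {y : Fin (d + 1) → MvPolynomial (Fin m) k} (hy : ∀ i, (y i).IsHomogeneous 1)
    (hJ : ∃ N, ∀ n, N ≤ n → ∀ p : MvPolynomial (Fin m) k, p.IsHomogeneous n →
      p ∈ J ⊔ Ideal.span (Set.range y))
    {F : MvPolynomial (Fin (d + 1)) k} {n : ℕ} (hF : F.IsHomogeneous n) (hF0 : F ≠ 0)
    (hFJ : aeval y F ∈ J) :
    ∃ z : Fin d → MvPolynomial (Fin m) k, (∀ i, (z i).IsHomogeneous 1) ∧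
      Ideal.span (Set.range z) ≤ Ideal.span (Set.range y) ∧
      ∃ N, ∀ n, N ≤ n → ∀ p : MvPolynomial (Fin m) k, p.IsHomogeneous n →
        p ∈ J ⊔ Ideal.span (Set.range z) := by
  -- The factor `X 0` forces `a 0 ≠ 0`, so that `a` can be rescaled.
  obtain ⟨a, ha⟩ : ∃ a, eval a (F * X 0) ≠ 0 := by
    by_contra! h
    exact mul_ne_zero hF0 (X_ne_zero 0) (MvPolynomial.funext fun a => by rw [h a, map_zero])
  rw [map_mul, eval_X] at ha
  have ha0 : a 0 ≠ 0 := right_ne_zero_of_mul ha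
  let c : Fin (d + 1) → k := fun j => a j / a 0
  have hc : eval c F ≠ 0 := by
    have h1 := aeval_smul_of_isHomogeneous hF c (a 0)
    have h2 : (fun j => c j • a 0) = a := by
      ext j
      simp [c, ha0]
    rw [h2] at h1
    intro h
    rw [h, zero_smul] at h1
    exact left_ne_zero_of_mul ha h1
  let z : Fin d → MvPolynomial (Fin m) k := fun j => y j.succ - C (c j.succ) * y 0
  refine ⟨z, fun i => (hy _).sub ((hy 0).C_mul _), ?_, ?_⟩
  · rw [Ideal.span_le]
    rintro _ ⟨j, rfl⟩
    exact sub_mem (Ideal.subset_span ⟨_, rfl⟩)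
      (Ideal.mul_mem_left _ _ (Ideal.subset_span ⟨_, rfl⟩))
  set K := J ⊔ Ideal.span (Set.range z) with hK
  have hz : ∀ j, Ideal.Quotient.mk K (y j) = c j • Ideal.Quotient.mk K (y 0) := by
    intro j
    have h3 : c j • Ideal.Quotient.mk K (y 0) = Ideal.Quotient.mk K (C (c j) * y 0) := by
      rw [← smul_eq_C_mul]; rfl
    rw [h3, Ideal.Quotient.mk_eq_mk_iff_sub_mem]
    refine Fin.cases ?_ (fun j => ?_) j
    · simp [c, ha0]
    · exact Ideal.mem_sup_right (Ideal.subset_span ⟨j, rfl⟩)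
  have hy0 : y 0 ^ n ∈ K := by
    have h4 : aeval (fun j => c j • Ideal.Quotient.mk K (y 0)) F = 0 := by
      have h5 : (fun j => c j • Ideal.Quotient.mk K (y 0)) =
          fun j => Ideal.Quotient.mkₐ k K (y j) := funext fun j => (hz j).symm
      rw [h5, ← comp_aeval_apply]
      exact Ideal.Quotient.eq_zero_iff_mem.2 (Ideal.mem_sup_left hFJ)
    rw [aeval_smul_of_isHomogeneous hF, smul_eq_zero_iff_right hc, ← map_pow,
      Ideal.Quotient.eq_zero_iff_mem] at h4
    exact h4
  have hyK : ∀ j, y j ^ n ∈ K := by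
    intro j
    rw [← Ideal.Quotient.eq_zero_iff_mem, map_pow, hz, smul_pow, ← map_pow,
      Ideal.Quotient.eq_zero_iff_mem.2 hy0, smul_zero]
  have hrad : J ⊔ Ideal.span (Set.range y) ≤ K.radical := by
    refine sup_le (le_sup_left.trans Ideal.le_radical) (Ideal.span_le.2 ?_)
    rintro _ ⟨j, rfl⟩
    exact ⟨n, hyK j⟩
  obtain ⟨N, hN⟩ := hJ
  have hX : idealOfVars (Fin m) k ≤ K.radical := by
    rw [idealOfVars, Ideal.span_le]
    rintro _ ⟨i, rfl⟩
    exact K.radical_idem.le ⟨N, hrad (hN N le_rfl _ (isHomogeneous_X_pow i N))⟩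
  exact exists_forms_mem_of_idealOfVars_le_radical hX

/-- A minimal number of linear forms generating a reduction are algebraically independent, as soon
as there is at least one of them. -/
theorem algebraicIndependent_of_minimal [Infinite k] {J : Ideal (MvPolynomial (Fin m) k)}
    (hJh : J.IsHomogeneous (homogeneousSubmodule (Fin m) k)) {d : ℕ}
    {y : Fin (d + 1) → MvPolynomial (Fin m) k} (hy : ∀ i, (y i).IsHomogeneous 1)
    (hJ : ∃ N, ∀ n, N ≤ n → ∀ p : MvPolynomial (Fin m) k, p.IsHomogeneous n →
      p ∈ J ⊔ Ideal.span (Set.range y))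
    (hmin : ¬ ∃ z : Fin d → MvPolynomial (Fin m) k, (∀ i, (z i).IsHomogeneous 1) ∧
      Ideal.span (Set.range z) ≤ Ideal.span (Set.range y) ∧
      ∃ N, ∀ n, N ≤ n → ∀ p : MvPolynomial (Fin m) k, p.IsHomogeneous n →
        p ∈ J ⊔ Ideal.span (Set.range z)) :
    AlgebraicIndependent k fun i => Ideal.Quotient.mkₐ k J (y i) := by
  rw [algebraicIndependent_iff]
  intro F hF
  rw [← comp_aeval_apply, Ideal.Quotient.mkₐ_eq_mk, Ideal.Quotient.eq_zero_iff_mem] at hF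
  by_contra hF0
  obtain ⟨n, hn⟩ : ∃ n, homogeneousComponent n F ≠ 0 := by
    by_contra! h
    exact hF0 (by rw [← sum_homogeneousComponent F]; exact Finset.sum_eq_zero fun n _ => h n)
  -- Since `J` is homogeneous and the `y i` are linear, each homogeneous component of a relation is
  -- again a relation.
  refine hmin (exists_fewer_generators hy hJ (homogeneousComponent_isHomogeneous n F) hn ?_)
  rw [aeval_homogeneousComponent hy]
  exact homogeneousComponent_mem_of_mem hJh hF _

end AlgebraicIndependence

/-! ### Growth of the Hilbert function -/

section HilbertFunction

open MvPolynomial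

variable {k : Type*} [Field k] {m : ℕ}

/-- The image in `k[x₁, …, xₘ] / J` of the polynomials of degree at most `n`. -/
noncomputable def filteredPiece (J : Ideal (MvPolynomial (Fin m) k)) (n : ℕ) :
    Submodule k (MvPolynomial (Fin m) k ⧸ J) :=
  (restrictTotalDegree (Fin m) k n).map (Ideal.Quotient.mkₐ k J).toLinearMap

instance filteredPiece_finite (J : Ideal (MvPolynomial (Fin m) k)) (n : ℕ) :
    Module.Finite k (filteredPiece J n) := by
  unfold filteredPiece; infer_instance

/-- Counts the monomials in `y` with all exponents at most `n`; their degree is at most `d * n`. -/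
theorem pow_le_finrank_filteredPiece {J : Ideal (MvPolynomial (Fin m) k)} {d : ℕ}
    {y : Fin d → MvPolynomial (Fin m) k} (hy : ∀ i, (y i).IsHomogeneous 1)
    (hind : AlgebraicIndependent k fun i => Ideal.Quotient.mkₐ k J (y i)) (n : ℕ) :
    (n + 1) ^ d ≤ Module.finrank k (filteredPiece J (d * n)) := by
  let a : (Fin d → Fin (n + 1)) → (Fin d →₀ ℕ) := fun α =>
    Finsupp.equivFunOnFinite.symm fun i => (α i : ℕ)
  have ha : Function.Injective a := fun α β h => by
    ext i
    exact DFunLike.congr_fun h i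
  have hli : LinearIndependent k fun α => aeval (fun i => Ideal.Quotient.mkₐ k J (y i))
      (monomial (a α) (1 : k)) := by
    have h1 := ((basisMonomials (Fin d) k).linearIndependent.comp a ha).map'
      (aeval (fun i => Ideal.Quotient.mkₐ k J (y i))).toLinearMap
      (LinearMap.ker_eq_bot.2 hind)
    simpa [Function.comp_def] using h1
  have hle : Submodule.span k (Set.range fun α => aeval (fun i => Ideal.Quotient.mkₐ k J (y i))
      (monomial (a α) (1 : k))) ≤ filteredPiece J (d * n) := by
    rw [Submodule.span_le]
    rintro _ ⟨α, rfl⟩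
    refine ⟨aeval y (monomial (a α) (1 : k)), ?_, ?_⟩
    · have h2 : (aeval y (monomial (a α) (1 : k))).IsHomogeneous (1 * (a α).degree) :=
        IsHomogeneous.aeval (isHomogeneous_monomial (1 : k) rfl) y hy
      refine (mem_restrictTotalDegree _ _ _).2 (h2.totalDegree_le.trans ?_)
      rw [one_mul, Finsupp.degree_eq_sum]
      calc ∑ i, a α i ≤ ∑ _i : Fin d, n :=
            Finset.sum_le_sum fun i _ => Nat.lt_succ_iff.1 (α i).2
        _ = d * n := by simp
    · exact comp_aeval_apply y (Ideal.Quotient.mkₐ k J) (monomial (a α) (1 : k))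
  calc (n + 1) ^ d = Fintype.card (Fin d → Fin (n + 1)) := by simp
    _ = _ := (finrank_span_eq_card hli).symm
    _ ≤ _ := Submodule.finrank_mono hle

/-- `R / I` is a finite module over `k[y]`, generated by the polynomials of degree at most `N`: in
higher degrees one factor `y i` can be split off, and induction on the degree bounds the exponents.
-/
theorem exists_finrank_filteredPiece_le {I : Ideal (MvPolynomial (Fin m) k)}
    (hI : I.IsHomogeneous (homogeneousSubmodule (Fin m) k)) {e : ℕ}
    {y : Fin e → MvPolynomial (Fin m) k} (hy : ∀ i, (y i).IsHomogeneous 1)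
    (hred : ∃ N, ∀ n, N ≤ n → ∀ p : MvPolynomial (Fin m) k, p.IsHomogeneous n →
      p ∈ I ⊔ Ideal.span (Set.range y)) :
    ∃ c, ∀ n, Module.finrank k (filteredPiece I n) ≤ (n + 1) ^ e * c := by
  obtain ⟨N, hN⟩ := hred
  let b := Module.finBasis k (restrictTotalDegree (Fin m) k N)
  let c := Module.finrank k (restrictTotalDegree (Fin m) k N)
  let gen : (Fin e → ℕ) → Fin c → MvPolynomial (Fin m) k :=
    fun α j => (∏ i, y i ^ α i) * (b j : MvPolynomial (Fin m) k)
  let S : ℕ → Submodule k (MvPolynomial (Fin m) k) := fun n =>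
    Submodule.span k {x | ∃ α : Fin e → ℕ, (∀ i, α i ≤ n) ∧ ∃ j, x = gen α j}
  have hSmono : Monotone S := fun n n' h =>
    Submodule.span_mono fun x ⟨α, hα, hx⟩ => ⟨α, fun i => (hα i).trans h, hx⟩
  have hS0 : restrictTotalDegree (Fin m) k N ≤ S 0 := by
    intro p hp
    have h1 := congrArg Subtype.val (b.sum_repr ⟨p, hp⟩)
    rw [AddSubmonoidClass.coe_finsetSum] at h1
    change _ = p at h1
    rw [← h1]
    refine Submodule.sum_mem _ fun j _ => Submodule.smul_mem _ _ (Submodule.subset_span ?_)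
    exact ⟨0, fun i => le_rfl, j, by simp [gen]⟩
  have hmul : ∀ n i, ∀ q ∈ I.restrictScalars k ⊔ S n,
      q * y i ∈ I.restrictScalars k ⊔ S (n + 1) := by
    intro n i q hq
    have hle : I.restrictScalars k ⊔ S n ≤
        (I.restrictScalars k ⊔ S (n + 1)).comap (LinearMap.mulRight k (y i)) := by
      refine sup_le (fun x hx => Submodule.mem_sup_left (I.mul_mem_right _ hx))
        (Submodule.span_le.2 ?_)
      rintro _ ⟨α, hα, j, rfl⟩
      refine Submodule.mem_sup_right (Submodule.subset_span
        ⟨α + Pi.single i 1, fun i' => ?_, j, ?_⟩)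
      · have h2 := hα i'
        have h3 : (Pi.single i 1 : Fin e → ℕ) i' ≤ 1 := by
          rw [Pi.single_apply]; split_ifs <;> simp
        exact add_le_add h2 h3
      · simp only [LinearMap.mulRight_apply, gen, Pi.add_apply, pow_add, Finset.prod_mul_distrib,
          Pi.single_apply, pow_ite, pow_one, pow_zero, Finset.prod_ite_eq', Finset.mem_univ, if_true]
        ring
    exact hle hq
  have hforms : ∀ n, ∀ p : MvPolynomial (Fin m) k, p.IsHomogeneous n →
      p ∈ I.restrictScalars k ⊔ S n := by
    intro n
    induction n with
    | zero =>
      intro p hp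
      exact Submodule.mem_sup_right (hS0 ((mem_restrictTotalDegree _ _ _).2
        (hp.totalDegree_le.trans (Nat.zero_le _))))
    | succ n ih =>
      intro p hp
      rcases le_total (n + 1) N with h | h
      · exact Submodule.mem_sup_right (hSmono (Nat.zero_le _) (hS0
          ((mem_restrictTotalDegree _ _ _).2 (hp.totalDegree_le.trans h))))
      · obtain ⟨q, hq, hpq⟩ := exists_forms_coeff_of_mem_sup_span hI hy hp (hN _ h p hp)
        rw [← sub_add_cancel p (∑ i, q i * y i)]
        exact add_mem (Submodule.mem_sup_left hpq)
          (Submodule.sum_mem _ fun i _ => hmul n i _ (ih _ (hq i)))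
  refine ⟨c, fun n => ?_⟩
  have hle : filteredPiece I n ≤ Submodule.span k (Set.range
      fun x : (Fin e → Fin (n + 1)) × Fin c =>
        Ideal.Quotient.mkₐ k I (gen (fun i => (x.1 i : ℕ)) x.2)) := by
    rintro _ ⟨p, hp, rfl⟩
    have hpS : p ∈ I.restrictScalars k ⊔ S n := by
      rw [← sum_homogeneousComponent p]
      refine Submodule.sum_mem _ fun i hi => ?_
      have hin : i ≤ n := (Nat.lt_succ_iff.1 (Finset.mem_range.1 hi)).trans
        ((mem_restrictTotalDegree _ _ _).1 hp)
      exact sup_le_sup_left (hSmono hin) _ (hforms i _ (homogeneousComponent_isHomogeneous i p))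
    have hle' : I.restrictScalars k ⊔ S n ≤ (Submodule.span k (Set.range
        fun x : (Fin e → Fin (n + 1)) × Fin c =>
          Ideal.Quotient.mkₐ k I (gen (fun i => (x.1 i : ℕ)) x.2))).comap
        (Ideal.Quotient.mkₐ k I).toLinearMap := by
      refine sup_le (fun x hx => ?_) (Submodule.span_le.2 ?_)
      · have h0 : (Ideal.Quotient.mkₐ k I).toLinearMap x = 0 := Ideal.Quotient.eq_zero_iff_mem.2 hx
        rw [Submodule.mem_comap, h0]
        exact zero_mem _
      · rintro _ ⟨α, hα, j, rfl⟩
        exact Submodule.subset_span ⟨(fun i => ⟨α i, Nat.lt_succ_iff.2 (hα i)⟩, j), rfl⟩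
    exact hle' hpS
  have : Module.Finite k (Submodule.span k (Set.range
      fun x : (Fin e → Fin (n + 1)) × Fin c =>
        Ideal.Quotient.mkₐ k I (gen (fun i => (x.1 i : ℕ)) x.2))) :=
    Module.Finite.span_of_finite k (Set.finite_range _)
  calc _ ≤ _ := Submodule.finrank_mono hle
    _ ≤ Fintype.card ((Fin e → Fin (n + 1)) × Fin c) := finrank_range_le_card _
    _ = (n + 1) ^ e * c := by simp

end HilbertFunction

/-! ### Initial ideals: homogeneity and Hilbert function -/

section InitialIdeal

open MvPolynomial

variable {k : Type*} [Field k] {m : ℕ} (w : (Fin m → ℤ) →ₗ[ℤ] ℤ)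

open Classical in
theorem coeff_initialForm (f : MvPolynomial (Fin m) k) (s : Fin m →₀ ℕ) :
    coeff s (initialForm w f) =
      if ∀ s' ∈ f.support, monomialWeight w s' ≤ monomialWeight w s then coeff s f else 0 := by
  rw [initialForm, coeff_sum]
  simp only [coeff_monomial]
  rw [Finset.sum_ite_eq']
  simp only [Finset.mem_filter, mem_support_iff]
  split_ifs <;> grind

theorem eq_zero_of_initialForm_eq_zero {f : MvPolynomial (Fin m) k} (h : initialForm w f = 0) :
    f = 0 := by
  by_contra hf
  obtain ⟨s, hs, hmax⟩ := f.support.exists_max_image (monomialWeight w) (support_nonempty.2 hf)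
  have h1 := coeff_initialForm w f s
  rw [if_pos hmax, h, coeff_zero] at h1
  exact mem_support_iff.1 hs h1.symm

/-- If some term of `f` of maximal weight has degree `n`, then `f` and its degree `n` component have
the same maximal weight; otherwise the left side vanishes. -/
theorem homogeneousComponent_initialForm (f : MvPolynomial (Fin m) k) (n : ℕ) :
    homogeneousComponent n (initialForm w f) = 0 ∨
      homogeneousComponent n (initialForm w f) = initialForm w (homogeneousComponent n f) := by
  classical
  by_cases h : ∃ s₀, s₀.degree = n ∧ s₀ ∈ f.support ∧
      ∀ s' ∈ f.support, monomialWeight w s' ≤ monomialWeight w s₀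
  · obtain ⟨s₀, hdeg, hs₀, hmax⟩ := h
    right
    ext s
    have key : (∀ s' ∈ (homogeneousComponent n f).support,
        monomialWeight w s' ≤ monomialWeight w s) ↔
        ∀ s' ∈ f.support, monomialWeight w s' ≤ monomialWeight w s := by
      constructor
      · intro h1 s' hs'
        refine (hmax s' hs').trans (h1 s₀ ?_)
        rw [mem_support_iff, coeff_homogeneousComponent, if_pos hdeg]
        exact mem_support_iff.1 hs₀
      · intro h1 s' hs'
        refine h1 s' ?_
        rw [mem_support_iff, coeff_homogeneousComponent] at hs'
        exact mem_support_iff.2 fun h0 => hs' (by rw [h0, ite_self])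
    rw [coeff_initialForm, coeff_homogeneousComponent, coeff_homogeneousComponent,
      coeff_initialForm]
    by_cases hs : s.degree = n
    · simp only [hs, if_true, key]
    · simp only [hs, if_false, ite_self]
  · left
    ext s
    rw [coeff_homogeneousComponent, coeff_initialForm, coeff_zero]
    split_ifs with h1 h2
    · by_contra h0
      exact h ⟨s, h1, mem_support_iff.2 h0, h2⟩
    · rfl
    · rfl

theorem initialForm_mem_initialIdeal {I : Ideal (MvPolynomial (Fin m) k)}
    {f : MvPolynomial (Fin m) k} (hf : f ∈ I) : initialForm w f ∈ initialIdeal w I :=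
  Ideal.subset_span ⟨f, hf, rfl⟩

theorem isHomogeneous_initialIdeal {I : Ideal (MvPolynomial (Fin m) k)}
    (hI : I.IsHomogeneous (homogeneousSubmodule (Fin m) k)) :
    (initialIdeal w I).IsHomogeneous (homogeneousSubmodule (Fin m) k) := by
  have h : initialIdeal w I =
      Ideal.span {g | ∃ f ∈ I, ∃ n, g = homogeneousComponent n (initialForm w f)} := by
    refine le_antisymm (Ideal.span_le.2 ?_) (Ideal.span_le.2 ?_)
    · rintro _ ⟨f, hf, rfl⟩
      rw [← sum_homogeneousComponent (initialForm w f)]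
      exact Submodule.sum_mem _ fun n _ => Ideal.subset_span ⟨f, hf, n, rfl⟩
    · rintro _ ⟨f, hf, n, rfl⟩
      rcases homogeneousComponent_initialForm w f n with h | h
      · rw [h]; exact zero_mem _
      · rw [h]
        exact initialForm_mem_initialIdeal w (homogeneousComponent_mem_of_mem hI hf n)
  rw [h]
  refine Ideal.homogeneous_span _ _ ?_
  rintro _ ⟨f, -, n, rfl⟩
  exact ⟨n, homogeneousComponent_isHomogeneous n _⟩

theorem eq_sum_monomial_of_support_subset {κ : Type*} [Fintype κ] {a : κ → (Fin m →₀ ℕ)}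
    (ha : Function.Injective a) {f : MvPolynomial (Fin m) k} (hf : ∀ s ∈ f.support, ∃ i, a i = s) :
    f = ∑ i, coeff (a i) f • monomial (a i) (1 : k) := by
  classical
  ext s
  simp only [coeff_sum, coeff_smul, coeff_monomial, smul_eq_mul, mul_ite, mul_one, mul_zero]
  by_cases hs : ∃ i, a i = s
  · obtain ⟨i, rfl⟩ := hs
    simp [ha.eq_iff]
  · rw [Finset.sum_eq_zero fun i _ => if_neg fun h => hs ⟨i, h⟩]
    by_contra h0
    exact hs (hf s (mem_support_iff.2 h0))

/-- Monomials independent modulo the initial ideal remain independent modulo `I`: a combination `p`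
of them in `I` has its initial form supported on the same monomials and lying in the initial ideal,
so the initial form is zero and `p = 0`. -/
theorem finrank_filteredPiece_initialIdeal_le (I : Ideal (MvPolynomial (Fin m) k)) (n : ℕ) :
    Module.finrank k (filteredPiece (initialIdeal w I) n) ≤
      Module.finrank k (filteredPiece I n) := by
  let v : {s : Fin m →₀ ℕ // s.degree ≤ n} → MvPolynomial (Fin m) k ⧸ initialIdeal w I :=
    fun s => Ideal.Quotient.mkₐ k _ (monomial s.1 1)
  obtain ⟨κ, a, ha, hspan, hli⟩ := exists_linearIndependent' k v
  have hsub : ∀ J : Ideal (MvPolynomial (Fin m) k), ∀ s : {s : Fin m →₀ ℕ // s.degree ≤ n},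
      Ideal.Quotient.mkₐ k J (monomial s.1 1) ∈ filteredPiece J n := fun J s =>
    ⟨_, (mem_restrictTotalDegree _ _ _).2
      ((isHomogeneous_monomial (1 : k) rfl).totalDegree_le.trans s.2), rfl⟩
  have hfin : Finite {s : Fin m →₀ ℕ // s.degree ≤ n} := Finsupp.finite_of_degree_le n
  have : Finite κ := Finite.of_injective a ha
  have : Fintype κ := Fintype.ofFinite κ
  have hle : filteredPiece (initialIdeal w I) n ≤ Submodule.span k (Set.range (v ∘ a)) := by
    rw [hspan]
    rintro _ ⟨p, hp, rfl⟩
    rw [← support_sum_monomial_coeff p, map_sum]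
    refine Submodule.sum_mem _ fun s hs => ?_
    have hsn : s.degree ≤ n :=
      (le_totalDegree hs).trans ((mem_restrictTotalDegree _ _ _).1 hp)
    rw [← mul_one (coeff s p), ← smul_eq_mul, ← smul_monomial, map_smul]
    exact Submodule.smul_mem _ _ (Submodule.subset_span ⟨⟨s, hsn⟩, rfl⟩)
  have hinj : Function.Injective fun i => (a i).1 := Subtype.val_injective.comp ha
  have hli' : LinearIndependent k fun i => Ideal.Quotient.mkₐ k I (monomial (a i).1 (1 : k)) := by
    rw [Fintype.linearIndependent_iff]
    intro g hg
    let p : MvPolynomial (Fin m) k := ∑ i, g i • monomial (a i).1 (1 : k)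
    have hpI : p ∈ I := by
      have hp : Ideal.Quotient.mkₐ k I p = 0 := by simpa only [p, map_sum, map_smul] using hg
      exact Ideal.Quotient.eq_zero_iff_mem.1 hp
    have hcoeff : ∀ i, coeff (a i).1 p = g i := by
      classical
      intro i
      simp only [p, coeff_sum, coeff_smul, coeff_monomial, smul_eq_mul, mul_ite, mul_one, mul_zero,
        hinj.eq_iff]
      simp
    have hsupp : ∀ s ∈ (initialForm w p).support, ∃ i, (a i).1 = s := by
      classical
      intro s hs
      by_contra hc
      refine mem_support_iff.1 hs ?_
      have hs0 : coeff s p = 0 := by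
        simp only [p, coeff_sum, coeff_smul, coeff_monomial, smul_eq_mul, mul_ite, mul_one,
          mul_zero]
        exact Finset.sum_eq_zero fun i _ => if_neg fun h => hc ⟨i, h⟩
      rw [coeff_initialForm, hs0, ite_self]
    have hexp := eq_sum_monomial_of_support_subset hinj hsupp
    have hmk : Ideal.Quotient.mkₐ k (initialIdeal w I) (initialForm w p) = 0 :=
      Ideal.Quotient.eq_zero_iff_mem.2 (initialForm_mem_initialIdeal w hpI)
    rw [hexp, map_sum] at hmk
    simp only [map_smul] at hmk
    have hzero := Fintype.linearIndependent_iff.1 hli _ hmk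
    have hp0 : p = 0 := by
      refine eq_zero_of_initialForm_eq_zero w ?_
      rw [hexp]
      exact Finset.sum_eq_zero fun i _ => by rw [hzero i, zero_smul]
    intro i
    rw [← hcoeff i, hp0, coeff_zero]
  have : Module.Finite k (Submodule.span k (Set.range (v ∘ a))) :=
    Module.Finite.span_of_finite k (Set.finite_range _)
  calc _ ≤ _ := Submodule.finrank_mono hle
    _ = Fintype.card κ := finrank_span_eq_card hli
    _ = _ := (finrank_span_eq_card hli').symm
    _ ≤ _ := Submodule.finrank_mono (Submodule.span_le.2 (by
      rintro _ ⟨i, rfl⟩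
      exact hsub I (a i)))

end InitialIdeal

/-! ### Degeneration to the initial ideal under a torus -/

section Degeneration

open MvPolynomial

variable {k : Type*} [Field k] {m : ℕ} (w : (Fin m → ℤ) →ₗ[ℤ] ℤ)

theorem monomialWeight_eq_sum (s : Fin m →₀ ℕ) :
    monomialWeight w s = ∑ i, (s i : ℤ) * w (Pi.single i 1) := by
  rw [monomialWeight, LinearMap.pi_apply_eq_sum_univ]
  refine Finset.sum_congr rfl fun i _ => ?_
  rw [smul_eq_mul]
  congr 2
  ext j
  simp [Pi.single_apply, eq_comm]

/-- The torus action `xᵢ ↦ u ^ wᵢ xᵢ` attached to the weight `w`. -/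
noncomputable def torusAction (u : k) : MvPolynomial (Fin m) k →ₐ[k] MvPolynomial (Fin m) k :=
  aeval fun i => C (u ^ w (Pi.single i 1)) * X i

theorem torusAction_monomial {u : k} (hu : u ≠ 0) (s : Fin m →₀ ℕ) (c : k) :
    torusAction w u (monomial s c) = monomial s (u ^ monomialWeight w s * c) := by
  rw [torusAction, aeval_monomial, Finsupp.prod_fintype _ _ (fun i => pow_zero _)]
  simp only [mul_pow, Finset.prod_mul_distrib]
  rw [monomialWeight_eq_sum, monomial_eq, Finsupp.prod_fintype _ _ (fun i => pow_zero _),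
    algebraMap_eq, C_mul, ← mul_assoc, mul_comm (C c)]
  congr 2
  simp only [← map_pow, ← map_prod]
  congr 1
  have : ∀ t : Finset (Fin m), u ^ (∑ i ∈ t, (s i : ℤ) * w (Pi.single i 1)) =
      ∏ i ∈ t, (u ^ w (Pi.single i 1)) ^ s i := by
    intro t
    induction t using Finset.cons_induction with
    | empty => simp
    | cons i t hi ih =>
      rw [Finset.sum_cons, Finset.prod_cons, zpow_add₀ hu, ih, mul_comm (s i : ℤ), zpow_mul,
        zpow_natCast]
  exact (this _).symm

theorem isHomogeneous_torusAction (u : k) {f : MvPolynomial (Fin m) k} {n : ℕ}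
    (hf : f.IsHomogeneous n) : (torusAction w u f).IsHomogeneous n := by
  have h := hf.aeval (fun i => C (u ^ w (Pi.single i 1)) * X i)
    (fun i => isHomogeneous_C_mul_X _ i)
  rwa [one_mul] at h

/-- `p` is the value at `0` of a curve, polynomial in each coefficient, whose values at `u ≠ 0`
are carried into `K u` by the torus action of `u`. -/
def IsTorusLimit (K : k → Ideal (MvPolynomial (Fin m) k)) (p : MvPolynomial (Fin m) k) : Prop :=
  ∃ P : (Fin m →₀ ℕ) → Polynomial k, (∀ s, (P s).eval 0 = coeff s p) ∧
    ∀ u : k, u ≠ 0 → ∃ q : MvPolynomial (Fin m) k,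
      torusAction w u q ∈ K u ∧ ∀ s, coeff s q = (P s).eval u

variable {w} {K : k → Ideal (MvPolynomial (Fin m) k)}

theorem isTorusLimit_of_forall_mem {p : MvPolynomial (Fin m) k}
    (h : ∀ u, u ≠ 0 → torusAction w u p ∈ K u) : IsTorusLimit w K p :=
  ⟨fun s => Polynomial.C (coeff s p), fun _ => Polynomial.eval_C,
    fun u hu => ⟨p, h u hu, fun _ => Polynomial.eval_C.symm⟩⟩

theorem IsTorusLimit.add {p p' : MvPolynomial (Fin m) k} (h : IsTorusLimit w K p)
    (h' : IsTorusLimit w K p') : IsTorusLimit w K (p + p') := by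
  obtain ⟨P, hP, hq⟩ := h
  obtain ⟨P', hP', hq'⟩ := h'
  refine ⟨P + P', fun s => ?_, fun u hu => ?_⟩
  · rw [Pi.add_apply, Polynomial.eval_add, hP, hP', coeff_add]
  · obtain ⟨q, hqK, hqc⟩ := hq u hu
    obtain ⟨q', hqK', hqc'⟩ := hq' u hu
    refine ⟨q + q', by rw [map_add]; exact add_mem hqK hqK', fun s => ?_⟩
    rw [Pi.add_apply, Polynomial.eval_add, coeff_add, hqc, hqc']

theorem IsTorusLimit.mul_left {p : MvPolynomial (Fin m) k} (h : IsTorusLimit w K p)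
    (g : MvPolynomial (Fin m) k) : IsTorusLimit w K (g * p) := by
  classical
  obtain ⟨P, hP, hq⟩ := h
  refine ⟨fun s => ∑ x ∈ Finset.HasAntidiagonal.antidiagonal s, Polynomial.C (coeff x.1 g) * P x.2,
    fun s => ?_, fun u hu => ?_⟩
  · simp only [Polynomial.eval_finsetSum, Polynomial.eval_mul, Polynomial.eval_C, hP, coeff_mul]
  · obtain ⟨q, hqK, hqc⟩ := hq u hu
    refine ⟨g * q, by rw [map_mul]; exact Ideal.mul_mem_left _ _ hqK, fun s => ?_⟩
    simp only [Polynomial.eval_finsetSum, Polynomial.eval_mul, Polynomial.eval_C, hqc, coeff_mul]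

/-- Torus limits form an ideal, so only generators need to be checked. -/
theorem isTorusLimit_of_mem_span {S : Set (MvPolynomial (Fin m) k)}
    (hS : ∀ p ∈ S, IsTorusLimit w K p) {p : MvPolynomial (Fin m) k} (hp : p ∈ Ideal.span S) :
    IsTorusLimit w K p := by
  induction hp using Submodule.span_induction with
  | mem x hx => exact hS x hx
  | zero => exact isTorusLimit_of_forall_mem fun u _ => by rw [map_zero]; exact zero_mem _
  | add x y _ _ hx hy => exact hx.add hy
  | smul a x _ hx => exact hx.mul_left a

theorem isTorusLimit_initialForm {f : MvPolynomial (Fin m) k} (hf : ∀ u, f ∈ K u) :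
    IsTorusLimit w K (initialForm w f) := by
  classical
  rcases eq_or_ne f 0 with rfl | hf0
  · refine isTorusLimit_of_forall_mem fun u _ => ?_
    simp [initialForm]
  obtain ⟨s₀, hs₀, hmax⟩ := f.support.exists_max_image (monomialWeight w) (support_nonempty.2 hf0)
  -- The term at `s` is scaled by `u` to the power of its weight deficit. The torus action turns
  -- this into `u ^ monomialWeight w s₀` times `f`, and at `u = 0` only the terms of maximal weight
  -- survive, as `0 ^ 0 = 1`.
  refine ⟨fun s => Polynomial.monomial (monomialWeight w s₀ - monomialWeight w s).toNat (coeff s f),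
    fun s => ?_, fun u hu => ?_⟩
  · rw [coeff_initialForm, Polynomial.eval_monomial]
    by_cases hs : s ∈ f.support
    · have h1 := hmax s hs
      split_ifs with h
      · have h2 := h s₀ hs₀
        rw [show monomialWeight w s₀ - monomialWeight w s = 0 by omega]
        simp
      · have h2 : monomialWeight w s < monomialWeight w s₀ := by
          by_contra h2
          exact h fun s' hs' => (hmax s' hs').trans (not_lt.1 h2)
        rw [zero_pow (by omega), mul_zero]
    · rw [notMem_support_iff.1 hs, zero_mul, ite_self]
  · refine ⟨∑ s ∈ f.support, monomial s (coeff s f *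
      u ^ (monomialWeight w s₀ - monomialWeight w s).toNat), ?_, fun s => ?_⟩
    · have h : torusAction w u (∑ s ∈ f.support, monomial s (coeff s f *
          u ^ (monomialWeight w s₀ - monomialWeight w s).toNat)) =
          C (u ^ monomialWeight w s₀) * f := by
        conv_rhs => rw [← support_sum_monomial_coeff f, Finset.mul_sum]
        rw [map_sum]
        refine Finset.sum_congr rfl fun s hs => ?_
        have h1 := hmax s hs
        rw [torusAction_monomial w hu, C_mul_monomial]
        congr 1
        rw [← zpow_natCast, Int.toNat_of_nonneg (by omega), zpow_sub₀ hu]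
        have h2 : u ^ monomialWeight w s ≠ 0 := zpow_ne_zero _ hu
        field_simp
      rw [h]
      exact Ideal.mul_mem_left _ _ (hf u)
    · rw [coeff_sum, Polynomial.eval_monomial]
      simp only [coeff_monomial]
      rw [Finset.sum_ite_eq']
      split_ifs with hs
      · rfl
      · rw [notMem_support_iff.1 hs, zero_mul]

/-- The curves through the monomials of degree `n` have a coefficient matrix that is the identity at
`0`. Its determinant is a nonzero polynomial, so the matrix is invertible at some `u ≠ 0`, where the
monomials can be recovered from the points of the curves. -/
theorem exists_forms_mem_of_isTorusLimit [Infinite k]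
    (hK : ∀ u, (K u).IsHomogeneous (homogeneousSubmodule (Fin m) k)) {n : ℕ}
    (h : ∀ p : MvPolynomial (Fin m) k, p.IsHomogeneous n → IsTorusLimit w K p) :
    ∃ u : k, u ≠ 0 ∧ ∀ p : MvPolynomial (Fin m) k, p.IsHomogeneous n → p ∈ K u := by
  classical
  have hfin : Finite {s : Fin m →₀ ℕ // s.degree = n} :=
    ((Finsupp.finite_of_degree_le n).subset fun s (hs : s.degree = n) => hs.le).to_subtype
  have : Fintype {s : Fin m →₀ ℕ // s.degree = n} := Fintype.ofFinite _
  have h' : ∀ s : {s : Fin m →₀ ℕ // s.degree = n},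
      IsTorusLimit w K (monomial s.1 (1 : k)) := fun s => h _ (isHomogeneous_monomial _ s.2)
  choose P hP0 hPu using h'
  let M : Matrix {s : Fin m →₀ ℕ // s.degree = n} {s : Fin m →₀ ℕ // s.degree = n}
    (Polynomial k) := fun s s' => P s s'.1
  have hM : ∀ u, M.det.eval u = (Matrix.of fun s s' => (M s s').eval u).det := fun u => by
    rw [← Polynomial.coe_evalRingHom, RingHom.map_det]
    rfl
  have hdet0 : M.det.eval 0 = 1 := by
    rw [hM]
    refine (congrArg Matrix.det ?_).trans Matrix.det_one
    ext s s'
    rw [Matrix.of_apply, hP0, coeff_monomial, Matrix.one_apply]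
    simp only [Subtype.ext_iff]
  have hdet : M.det ≠ 0 := fun h0 => by simp [h0] at hdet0
  obtain ⟨u, hu⟩ : ∃ u, (M.det * Polynomial.X).eval u ≠ 0 := by
    by_contra! h0
    exact mul_ne_zero hdet Polynomial.X_ne_zero (Polynomial.funext fun u => by simpa using h0 u)
  rw [Polynomial.eval_mul, Polynomial.eval_X, hM] at hu
  have hu0 : u ≠ 0 := right_ne_zero_of_mul hu
  refine ⟨u, hu0, ?_⟩
  choose q hqK hqc using fun s => hPu s u hu0
  set B : Matrix {s : Fin m →₀ ℕ // s.degree = n} {s : Fin m →₀ ℕ // s.degree = n} k :=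
    Matrix.of fun s s' => (M s s').eval u with hB
  have hBinv : B⁻¹ * B = 1 := Matrix.nonsing_inv_mul _ (left_ne_zero_of_mul hu).isUnit
  have hmon : ∀ s : {s : Fin m →₀ ℕ // s.degree = n},
      torusAction w u (monomial s.1 (1 : k)) ∈ K u := by
    intro s
    -- The `q s'` may have terms outside degree `n`; passing to components is harmless because `K u`
    -- is homogeneous and the torus action preserves degree.
    have h1 : monomial s.1 (1 : k) = ∑ s', C (B⁻¹ s s') * homogeneousComponent n (q s') := by
      ext t
      simp only [coeff_sum, coeff_C_mul, coeff_homogeneousComponent]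
      by_cases ht : t.degree = n
      · have h2 := congrFun (congrFun hBinv s) ⟨t, ht⟩
        rw [Matrix.mul_apply, Matrix.one_apply] at h2
        simp only [ht, if_true, hqc, coeff_monomial]
        refine Eq.trans ?_ h2.symm
        simp only [Subtype.ext_iff]
      · simp only [ht, if_false, mul_zero, Finset.sum_const_zero, coeff_monomial]
        exact if_neg fun h2 : s.1 = t => ht (h2 ▸ s.2)
    rw [h1, map_sum]
    refine Submodule.sum_mem _ fun s' _ => ?_
    rw [map_mul]
    refine Ideal.mul_mem_left _ _ ?_
    have h3 : torusAction w u (homogeneousComponent n (q s')) =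
        homogeneousComponent n (torusAction w u (q s')) :=
      aeval_homogeneousComponent (fun i => isHomogeneous_C_mul_X _ i) _ _
    rw [h3]
    exact homogeneousComponent_mem_of_mem (hK u) (hqK s') n
  intro p hp
  rw [← support_sum_monomial_coeff p]
  refine Submodule.sum_mem _ fun s hs => ?_
  have hsn : s.degree = n := by
    by_contra hne
    exact mem_support_iff.1 hs (hp.coeff_eq_zero hne)
  have h4 := Ideal.mul_mem_left _ (C (u ^ (-monomialWeight w s) * coeff s p)) (hmon ⟨s, hsn⟩)
  rw [torusAction_monomial w hu0, C_mul_monomial] at h4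
  convert h4 using 2
  rw [zpow_neg]
  have h5 : u ^ monomialWeight w s ≠ 0 := zpow_ne_zero _ hu0
  field_simp

/-- If the forms of degree `n` lie in `in(I) + (y)` with `y` linear forms, then they lie in
`I + (z)` for suitable linear forms `z` with the same index set. -/
theorem exists_forms_mem_sup_span_of_initialIdeal [Infinite k]
    {I : Ideal (MvPolynomial (Fin m) k)}
    (hI : I.IsHomogeneous (homogeneousSubmodule (Fin m) k)) {ι : Type*}
    {y : ι → MvPolynomial (Fin m) k} (hy : ∀ i, (y i).IsHomogeneous 1) {n : ℕ}
    (h : ∀ p : MvPolynomial (Fin m) k, p.IsHomogeneous n →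
      p ∈ initialIdeal w I ⊔ Ideal.span (Set.range y)) :
    ∃ z : ι → MvPolynomial (Fin m) k, (∀ i, (z i).IsHomogeneous 1) ∧
      ∀ p : MvPolynomial (Fin m) k, p.IsHomogeneous n → p ∈ I ⊔ Ideal.span (Set.range z) := by
  let K : k → Ideal (MvPolynomial (Fin m) k) := fun u =>
    I ⊔ Ideal.span (Set.range fun i => torusAction w u (y i))
  have hK : ∀ u, (K u).IsHomogeneous (homogeneousSubmodule (Fin m) k) := fun u =>
    hI.sup (Ideal.homogeneous_span _ _ (by
      rintro _ ⟨i, rfl⟩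
      exact ⟨1, isHomogeneous_torusAction w u (hy i)⟩))
  obtain ⟨u, -, hu⟩ := exists_forms_mem_of_isTorusLimit (w := w) hK (n := n) fun p hp => by
    have hp' := h p hp
    rw [initialIdeal, ← Ideal.span_union] at hp'
    refine isTorusLimit_of_mem_span ?_ hp'
    rintro _ (⟨f, hf, rfl⟩ | ⟨i, rfl⟩)
    · exact isTorusLimit_initialForm fun u => Ideal.mem_sup_left hf
    · exact isTorusLimit_of_forall_mem fun u _ =>
        Ideal.mem_sup_right (Ideal.subset_span ⟨i, rfl⟩)
  exact ⟨_, fun i => isHomogeneous_torusAction w u (hy i), hu⟩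

end Degeneration

/-! ### Comparison of reduction numbers -/

section ReductionNumber

open MvPolynomial

variable {k : Type*} [Field k] {m : ℕ}

theorem le_of_forall_pow_le {d e c : ℕ}
    (h : ∀ n, (n + 1) ^ d ≤ (d * n + 1) ^ e * c) : d ≤ e := by
  by_contra! hlt
  -- For this `n` the right side is at most `(d * (n + 1)) ^ e * c = (n + 1) ^ e * n`, which is less
  -- than `(n + 1) ^ (e + 1)`.
  have h1 := h (d ^ e * c)
  set n := d ^ e * c with hn
  have h2 : (n + 1) ^ e * (n + 1) ≤ (n + 1) ^ e * n :=
    calc (n + 1) ^ e * (n + 1) = (n + 1) ^ (e + 1) := (pow_succ _ _).symm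
      _ ≤ (n + 1) ^ d := Nat.pow_le_pow_right (Nat.succ_pos n) hlt
      _ ≤ (d * n + 1) ^ e * c := h1
      _ ≤ (d * (n + 1)) ^ e * c :=
        Nat.mul_le_mul_right _ (Nat.pow_le_pow_left (by rw [mul_add]; omega) _)
      _ = (n + 1) ^ e * n := by rw [hn, mul_pow]; ring
  have h3 := Nat.le_of_mul_le_mul_left h2 (pow_pos (Nat.succ_pos n) e)
  omega

theorem IsReduction.exists_forms_mem {I K : Ideal (MvPolynomial (Fin m) k)}
    (h : IsReduction (quotientPiece I) (K.map (Ideal.Quotient.mk I))) :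
    ∃ N, ∀ n, N ≤ n → ∀ p : MvPolynomial (Fin m) k, p.IsHomogeneous n → p ∈ I ⊔ K := by
  simpa only [quotientPiece_le_map_iff] using h.2

/-- A minimal reduction of `R / in(I)` is generated by `d` linear forms for some `d` such that
every reduction of `R / I` contains at least `d` independent linear forms. -/
theorem exists_generators_card_le_linearRank [Infinite k] {I : Ideal (MvPolynomial (Fin m) k)}
    (hI : I.IsHomogeneous (homogeneousSubmodule (Fin m) k)) (w : (Fin m → ℤ) →ₗ[ℤ] ℤ)
    {Q : Ideal (MvPolynomial (Fin m) k ⧸ initialIdeal w I)}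
    (hQ : IsMinimalReduction (quotientPiece (initialIdeal w I)) Q) :
    ∃ (d : ℕ) (y : Fin d → MvPolynomial (Fin m) k), (∀ i, (y i).IsHomogeneous 1) ∧
      Q = (Ideal.span (Set.range y)).map (Ideal.Quotient.mk (initialIdeal w I)) ∧
      ∀ Q' : Ideal (MvPolynomial (Fin m) k ⧸ I), IsReduction (quotientPiece I) Q' →
        d ≤ linearRank I Q' := by
  classical
  have hex : ∃ d, ∃ y : Fin d → MvPolynomial (Fin m) k, (∀ i, (y i).IsHomogeneous 1) ∧
      Q = (Ideal.span (Set.range y)).map (Ideal.Quotient.mk (initialIdeal w I)) :=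
    ⟨_, exists_generators hQ.1⟩
  obtain ⟨d, ⟨y, hy, rfl⟩, hmin⟩ : ∃ d, (∃ y : Fin d → MvPolynomial (Fin m) k,
      (∀ i, (y i).IsHomogeneous 1) ∧
      Q = (Ideal.span (Set.range y)).map (Ideal.Quotient.mk (initialIdeal w I))) ∧
      ∀ d' < d, ¬ ∃ y : Fin d' → MvPolynomial (Fin m) k, (∀ i, (y i).IsHomogeneous 1) ∧
      Q = (Ideal.span (Set.range y)).map (Ideal.Quotient.mk (initialIdeal w I)) :=
    ⟨Nat.find hex, Nat.find_spec hex, fun d' hd' => Nat.find_min hex hd'⟩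
  refine ⟨d, y, hy, rfl, fun Q' hQ' => ?_⟩
  rcases d with _ | d
  · exact Nat.zero_le _
  have hind := algebraicIndependent_of_minimal (isHomogeneous_initialIdeal w hI) hy
    -- A reduction inside `Q` generated by `d` linear forms would equal `Q` by minimality,
    -- contradicting the choice of `d + 1`.
    hQ.1.exists_forms_mem (by
      rintro ⟨z, hz, hle, hred⟩
      exact hmin d (Nat.lt_succ_self d) ⟨z, hz,
        (hQ.2 _ (isReduction_map_span hz hred) (Ideal.map_mono hle)).symm⟩)
  obtain ⟨x, hx, hxQ⟩ := exists_generators hQ'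
  obtain ⟨c, hc⟩ := exists_finrank_filteredPiece_le hI hx (hxQ ▸ hQ').exists_forms_mem
  exact le_of_forall_pow_le fun n =>
    (pow_le_finrank_filteredPiece hy hind n).trans
      ((finrank_filteredPiece_initialIdeal_le w I _).trans (hc _))

end ReductionNumber

theorem theorem3p3 {k : Type*} [Field k] [Infinite k] (m : ℕ)
    (I : Ideal (MvPolynomial (Fin m) k))
    (hI : I.IsHomogeneous (MvPolynomial.homogeneousSubmodule (Fin m) k))
    (w : (Fin m → ℤ) →ₗ[ℤ] ℤ) :
    reductionNumber (quotientPiece I) ≤ reductionNumber (quotientPiece (initialIdeal w I)) := by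
  -- Existence matters: `sInf ∅ = 0` in `ℕ`, so the infimum is attained only because the set is
  -- nonempty.
  obtain ⟨Q₀, hQ₀⟩ := exists_isMinimalReduction (initialIdeal w I)
  obtain ⟨Q, hQ, hr⟩ := Nat.sInf_mem (s := {r : ℕ | ∃ Q, IsMinimalReduction
    (quotientPiece (initialIdeal w I)) Q ∧
      reductionNumberWrt (quotientPiece (initialIdeal w I)) Q = r}) ⟨_, Q₀, hQ₀, rfl⟩
  change _ = reductionNumber (quotientPiece (initialIdeal w I)) at hr
  rw [← hr]
  have hmem : quotientPiece (initialIdeal w I)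
      (reductionNumberWrt (quotientPiece (initialIdeal w I)) Q + 1) ≤ Q.restrictScalars k := by
    obtain ⟨N, hN⟩ := hQ.1.2
    exact Nat.sInf_mem (s := {n : ℕ | quotientPiece (initialIdeal w I) (n + 1) ≤
      Q.restrictScalars k}) ⟨N, hN _ (Nat.le_succ N)⟩
  set r := reductionNumberWrt (quotientPiece (initialIdeal w I)) Q
  obtain ⟨d, y, hy, hQy, hd⟩ := exists_generators_card_le_linearRank hI w hQ
  rw [hQy, quotientPiece_le_map_iff] at hmem
  obtain ⟨z, hz, hzr⟩ := exists_forms_mem_sup_span_of_initialIdeal hI hy hmem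
  -- Containing all forms of the single degree `r + 1` already puts a power of each variable in the
  -- ideal, hence all forms of large degree.
  have hred := isReduction_map_span hz (exists_forms_mem_of_forms_mem hzr)
  have hminred : IsMinimalReduction (quotientPiece I)
      ((Ideal.span (Set.range z)).map (Ideal.Quotient.mk I)) :=
    ⟨hred, fun Q' hQ' hle => eq_of_le_of_linearRank_le hred hQ' hle
      ((linearRank_map_span_le hI hz).trans (hd Q' hQ'))⟩
  calc reductionNumber (quotientPiece I)
      ≤ reductionNumberWrt (quotientPiece I)
          ((Ideal.span (Set.range z)).map (Ideal.Quotient.mk I)) :=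
        Nat.sInf_le ⟨_, hminred, rfl⟩
    _ ≤ r := Nat.sInf_le ((quotientPiece_le_map_iff I _ _).2 hzr)
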